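/- Let $n,m\ge 0$, let $X\subset\mathbb R^n$ be a nonempty finite union of convex polyhedra, and let $S:X\rightrightarrows\mathbb R^m$ be a piecewise polyhedral set-valued map, i.e. each $S(x)$, $x\in X$, is a (possibly empty) subset of $\mathbb R^m$ and $\mathrm{Graph}(S)=\{(x,y): x\in X,\ y\in S(x)\}$ is a finite union of convex polyhedra in $\mathbb R^n\times\mathbb R^m$. (A convex polyhedron is the solution set of finitely many affine inequalities. In particular one may take $X=\mathrm{dom}\,S=\{x: S(x)\neq\emptyset\}$, or $X=\mathbb R^n$.) Write $\mathbb B$ for the closed Euclidean unit ball. For $\rho>0$ let $\mathcal D_\rho(A,B)\in[0,\infty]$ be the infimum of all $\delta>0$ with $A\cap\rho\mathbb B\subset B+\delta\mathbb B$ and $B\cap\rho\mathbb B\subset A+\delta\mathbb B$. The map $S$ is *strictly continuous* at $\bar x\in X$ (relative to $X$) if for every $\rho>0$ $$\limsup_{\substack{x,x'\to\bar x,\ x,x'\in X\\ x\ne x'}}\frac{\mathcal D_\rho(S(x),S(x'))}{|x-x'|}<\infty .$$ The *graphical modulus* $\mathrm{lip}_XS(\bar x\mid\bar y)$ is the infimum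 of all $\kappa\ge 0$ for which there are neighbourhoods $V$ of $\bar x$ and $W$ of $\bar y$ such that $$S(x')\cap W\subset S(x)+\kappa|x'-x|\mathbb B\quad\text{for all }x,x'\in X\cap V$$ (and $\infty$ if there is no such $\kappa$). The dimension of a semialgebraic set is the largest dimension of a $C^1$ manifold contained in it, with $\dim\emptyset=-\infty$. Then: 1. there is a semialgebraic set $X'\subset X$ with $\dim X'<\dim X$ such that $S$ is strictly continuous at every point of $X\setminus X'$; 2. there is a real number $\bar\kappa>0$ such that for every $\bar x\in X$ at which $S$ is strictly continuous and every $\bar y\in S(\bar x)$, the graphical modulus $\mathrm{lip}_XS(\bar x\mid\bar y)$ is finite and smaller than $\bar\kappa$. -/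

import Mathlib

open Set Filter Topology
open scoped NNReal ENNReal Pointwise

/-- `ℝⁿ` with its Euclidean norm. -/
abbrev Rn (n : ℕ) : Type := EuclideanSpace ℝ (Fin n)

/-- A convex polyhedron: the solution set of finitely many affine inequalities. (An affine equation
is a pair of inequalities; the empty set and the whole space are polyhedra.) -/
def IsPolyhedron {V : Type*} [AddCommGroup V] [Module ℝ V] (P : Set V) : Prop :=
  ∃ (k : ℕ) (f : Fin k → V →ₗ[ℝ] ℝ) (b : Fin k → ℝ), P = {z | ∀ i, f i z ≤ b i}

/-- A finite union of convex polyhedra. -/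
def IsPiecewisePolyhedral {V : Type*} [AddCommGroup V] [Module ℝ V] (A : Set V) : Prop :=
  ∃ (N : ℕ) (P : Fin N → Set V), (∀ i, IsPolyhedron (P i)) ∧ A = ⋃ i, P i

/-- A set-valued map `S : X ⇉ ℝᵐ`, `X ⊆ ℝⁿ`, is given by a function `S` whose values outside `X`
are irrelevant; this is its graph. -/
def setValuedGraph {n m : ℕ} (X : Set (Rn n)) (S : Rn n → Set (Rn m)) : Set (Rn n × Rn m) :=
  {z | z.1 ∈ X ∧ z.2 ∈ S z.1}

/-- Semialgebraic subsets of `ℝⁿ`: finite unions of sets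
`{x | p x = 0, q₁ x > 0, …, q_ℓ x > 0}` with polynomials `p, q₁, …, q_ℓ`. -/
def IsSemialgebraic {n : ℕ} (A : Set (Rn n)) : Prop :=
  ∃ (k : ℕ) (p : Fin k → MvPolynomial (Fin n) ℝ) (q : Fin k → Finset (MvPolynomial (Fin n) ℝ)),
    A = ⋃ i, {x : Rn n | MvPolynomial.eval (fun j => x j) (p i) = 0 ∧
      ∀ r ∈ q i, 0 < MvPolynomial.eval (fun j => x j) r}

/-- `A` contains a nonempty `d`-dimensional `C¹` submanifold piece: the image of a nonempty open
subset of `ℝᵈ` under a `C¹` immersion. -/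
def ContainsManifold {n : ℕ} (A : Set (Rn n)) (d : ℕ) : Prop :=
  ∃ (U : Set (Rn d)) (φ : Rn d → Rn n), IsOpen U ∧ U.Nonempty ∧ ContDiffOn ℝ 1 φ U ∧
    (∀ u ∈ U, Function.Injective (fderiv ℝ φ u)) ∧ φ '' U ⊆ A

/-- The dimension of a semialgebraic set: the largest dimension of a manifold contained in it,
i.e. the highest dimension of a stratum of a stratification. The empty set has dimension `⊥`
(that is, `-∞`). -/
noncomputable def semialgDim {n : ℕ} (A : Set (Rn n)) : WithBot ℕ∞ :=
  ⨆ (d : ℕ) (_ : ContainsManifold A d), ((d : ℕ∞) : WithBot ℕ∞)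

/-- The Hausdorff distance truncated at radius `ρ`: the infimum of all `δ > 0` with
`A ∩ ρ𝔹 ⊆ B + δ𝔹` and `B ∩ ρ𝔹 ⊆ A + δ𝔹` (it is `∞` if there are none). -/
noncomputable def truncHausdorffDist {m : ℕ} (ρ : ℝ) (A B : Set (Rn m)) : ℝ≥0∞ :=
  ⨅ (δ : ℝ≥0) (_ : 0 < δ ∧
      A ∩ Metric.closedBall 0 ρ ⊆ B + Metric.closedBall 0 (δ : ℝ) ∧
      B ∩ Metric.closedBall 0 ρ ⊆ A + Metric.closedBall 0 (δ : ℝ)), (δ : ℝ≥0∞)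

/-- The Lipschitz modulus at `a` relative to `X`, at truncation radius `ρ`: the upper limit of
`truncHausdorffDist ρ (S x) (S x') / ‖x - x'‖` as `x, x' → a` with `x, x' ∈ X`, `x ≠ x'`. -/
noncomputable def lipModulus {n m : ℕ} (X : Set (Rn n)) (S : Rn n → Set (Rn m)) (ρ : ℝ)
    (a : Rn n) : ℝ≥0∞ :=
  limsup (fun p : Rn n × Rn n => truncHausdorffDist ρ (S p.1) (S p.2) / ‖p.1 - p.2‖ₑ)
    ((𝓝[X] a ×ˢ 𝓝[X] a) ⊓ 𝓟 {p | p.1 ≠ p.2})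

/-- `S : X ⇉ ℝᵐ` is strictly continuous at `a` relative to `X`. -/
def StrictlyContinuousAt {n m : ℕ} (X : Set (Rn n)) (S : Rn n → Set (Rn m)) (a : Rn n) : Prop :=
  ∀ ρ : ℝ, 0 < ρ → lipModulus X S ρ a < ⊤

/-- The graphical modulus `lip_X S(a | u)`: the infimum of all `κ ≥ 0` for which there are
neighbourhoods `V` of `a` and `W` of `u` with `S x' ∩ W ⊆ S x + κ ‖x' - x‖ 𝔹` for all
`x, x' ∈ X ∩ V`. It is `∞` if there is no such `κ`. -/
noncomputable def graphicalModulus {n m : ℕ} (X : Set (Rn n)) (S : Rn n → Set (Rn m)) (a : Rn n)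
    (u : Rn m) : ℝ≥0∞ :=
  ⨅ (κ : ℝ≥0) (_ : ∃ V ∈ 𝓝 a, ∃ W ∈ 𝓝 u, ∀ x ∈ X ∩ V, ∀ x' ∈ X ∩ V,
      S x' ∩ W ⊆ S x + Metric.closedBall 0 ((κ : ℝ) * ‖x' - x‖)), (κ : ℝ≥0∞)

/-- The signs at `z` of the affine functions `f i - b i`. -/
noncomputable def signVector {ι V : Type*} [AddCommGroup V] [Module ℝ V]
    (f : ι → V →ₗ[ℝ] ℝ) (b : ι → ℝ) (z : V) : ι → SignType :=
  fun i => SignType.sign (f i z - b i)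

/-- The directions along which all the affine functions `f i - b i` vanishing at `z` stay zero. -/
def zeroDirections {ι V : Type*} [AddCommGroup V] [Module ℝ V]
    (f : ι → V →ₗ[ℝ] ℝ) (b : ι → ℝ) (z : V) : Submodule ℝ V :=
  ⨅ i, ⨅ (_ : f i z = b i), LinearMap.ker (f i)

/-- A linear map sending polyhedra to polyhedra, such that the fibres of every polyhedron
depend in a Lipschitz way on the base point. -/
def HasLipschitzFibres {V W : Type*} [NormedAddCommGroup V] [NormedSpace ℝ V]
    [NormedAddCommGroup W] [NormedSpace ℝ W] (π : V →ₗ[ℝ] W) : Prop :=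
  ∀ P : Set V, IsPolyhedron P → IsPolyhedron (π '' P) ∧
    ∃ κ : ℝ, 0 ≤ κ ∧ ∀ z ∈ P, ∀ z₀ ∈ P, ∃ z' ∈ P, π z' = π z₀ ∧ ‖z - z'‖ ≤ κ * ‖π z - π z₀‖

section Polyhedra

theorem isPolyhedron_setOf {ι V : Type*} [Fintype ι] [AddCommGroup V] [Module ℝ V]
    (f : ι → V →ₗ[ℝ] ℝ) (b : ι → ℝ) : IsPolyhedron {z | ∀ i, f i z ≤ b i} := by
  refine ⟨Fintype.card ι, f ∘ (Fintype.equivFin ι).symm, b ∘ (Fintype.equivFin ι).symm, ?_⟩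
  ext z
  simp only [mem_ofPred_eq, Function.comp]
  exact ⟨fun h i => h _, fun h i => by simpa using h (Fintype.equivFin ι i)⟩

theorem exists_signVector_determines {κ V : Type} [Fintype κ] [AddCommGroup V] [Module ℝ V]
    {P : κ → Set V} (hP : ∀ k, IsPolyhedron (P k)) :
    ∃ (ι : Type) (_ : Fintype ι) (f : ι → V →ₗ[ℝ] ℝ) (b : ι → ℝ), ∀ k z z',
      signVector f b z = signVector f b z' → z ∈ P k → z' ∈ P k := by
  choose d f b h using hP
  refine ⟨Σ k, Fin (d k), inferInstance, fun i => f i.1 i.2, fun i => b i.1 i.2, ?_⟩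
  intro k z z' hs hz
  rw [h k] at hz ⊢
  intro i
  have h1 := congrFun hs ⟨k, i⟩
  simp only [signVector] at h1
  have h2 : f k i z - b k i ≤ 0 := sub_nonpos.2 (hz i)
  rw [← sub_nonpos, ← sign_nonpos_iff, ← h1, sign_nonpos_iff]
  exact h2

theorem IsPiecewisePolyhedral.exists_signVector {V : Type} [AddCommGroup V] [Module ℝ V]
    {A : Set V} (hA : IsPiecewisePolyhedral A) :
    ∃ (ι : Type) (_ : Fintype ι) (f : ι → V →ₗ[ℝ] ℝ) (b : ι → ℝ), ∀ z z',
      signVector f b z = signVector f b z' → z ∈ A → z' ∈ A := by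
  obtain ⟨N, P, hP, rfl⟩ := hA
  obtain ⟨ι, hι, f, b, h⟩ := exists_signVector_determines hP
  refine ⟨ι, hι, f, b, fun z z' hs hz => ?_⟩
  rw [mem_iUnion] at hz ⊢
  exact hz.imp fun k hk => h k z z' hs hk

theorem HasLipschitzFibres.comp {V W Y : Type*} [NormedAddCommGroup V] [NormedSpace ℝ V]
    [NormedAddCommGroup W] [NormedSpace ℝ W] [NormedAddCommGroup Y] [NormedSpace ℝ Y]
    {σ : W →ₗ[ℝ] Y} {π : V →ₗ[ℝ] W} (hσ : HasLipschitzFibres σ) (hπ : HasLipschitzFibres π) :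
    HasLipschitzFibres (σ ∘ₗ π) := by
  intro P hP
  obtain ⟨hQ, κ₁, h₁, H₁⟩ := hπ P hP
  obtain ⟨hR, κ₂, h₂, H₂⟩ := hσ _ hQ
  refine ⟨by rwa [LinearMap.coe_comp, image_comp], κ₁ * κ₂, by positivity, fun z hz z₀ hz₀ => ?_⟩
  obtain ⟨_, ⟨z₁, hz₁, rfl⟩, he, hle⟩ := H₂ _ (mem_image_of_mem π hz) _ (mem_image_of_mem π hz₀)
  obtain ⟨z', hz', he', hle'⟩ := H₁ z hz z₁ hz₁
  refine ⟨z', hz', by simp [he', he], hle'.trans ?_⟩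
  rw [mul_assoc]
  exact mul_le_mul_of_nonneg_left hle h₁

theorem LinearEquiv.hasLipschitzFibres {V W : Type*} [NormedAddCommGroup V] [NormedSpace ℝ V]
    [NormedAddCommGroup W] [NormedSpace ℝ W] [FiniteDimensional ℝ W] (e : V ≃ₗ[ℝ] W) :
    HasLipschitzFibres (e : V →ₗ[ℝ] W) := by
  intro P hP
  constructor
  · obtain ⟨k, f, b, rfl⟩ := hP
    refine ⟨k, fun i => f i ∘ₗ e.symm, b, ?_⟩
    ext w
    constructor
    · rintro ⟨z, hz, rfl⟩
      simpa using hz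
    · intro h
      exact ⟨e.symm w, by simpa using h, by simp⟩
  · let T := LinearMap.toContinuousLinearMap (e.symm : W →ₗ[ℝ] V)
    refine ⟨‖T‖, norm_nonneg _, fun z _ z₀ hz₀ => ⟨z₀, hz₀, rfl, ?_⟩⟩
    have := T.le_opNorm (e z - e z₀)
    simpa [T] using this

theorem exists_near_between_of_forall_le {I J : Type*} [Finite I] {l : I → ℝ} {u : J → ℝ} {t δ : ℝ}
    (hδ : 0 ≤ δ) (hlu : ∀ i j, l i ≤ u j) (hl : ∀ i, l i ≤ t + δ) (hu : ∀ j, t - δ ≤ u j) :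
    ∃ t', (∀ i, l i ≤ t') ∧ (∀ j, t' ≤ u j) ∧ |t - t'| ≤ δ := by
  let g : Option I → ℝ := fun o => o.elim (t - δ) l
  obtain ⟨o, ho⟩ := Finite.exists_max g
  refine ⟨g o, fun i => ho (some i), fun j => ?_, ?_⟩
  · cases o with
    | none => exact hu j
    | some i => exact hlu i j
  · have h1 : t - δ ≤ g o := ho none
    have h2 : g o ≤ t + δ := by
      cases o with
      | none => simp only [g, Option.elim]; linarith
      | some i => exact hl i
    rw [abs_le]
    constructor <;> linarith

theorem hasLipschitzFibres_fst_real {W : Type*} [NormedAddCommGroup W] [NormedSpace ℝ W]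
    [FiniteDimensional ℝ W] : HasLipschitzFibres (LinearMap.fst ℝ W ℝ) := by
  rintro _ ⟨k, f, b, rfl⟩
  let c : Fin k → ℝ := fun i => f i (0, 1)
  let h : Fin k → W →ₗ[ℝ] ℝ := fun i => f i ∘ₗ LinearMap.inl ℝ W ℝ
  have hf : ∀ i w t, f i (w, t) = h i w + t * c i := by
    intro i w t
    have : ((w, t) : W × ℝ) = (w, 0) + t • (0, 1) := by simp
    rw [this, map_add, map_smul]
    rfl
  let v : Fin k → W → ℝ := fun i w => (b i - h i w) / c i
  have hpos : ∀ i w t, 0 < c i → (f i (w, t) ≤ b i ↔ t ≤ v i w) := by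
    intro i w t hc
    rw [hf, le_div_iff₀ hc]
    constructor <;> intro <;> linarith
  have hneg : ∀ i w t, c i < 0 → (f i (w, t) ≤ b i ↔ v i w ≤ t) := by
    intro i w t hc
    rw [hf, div_le_iff_of_neg hc]
    constructor <;> intro <;> linarith
  have hzero : ∀ i w t, c i = 0 → (f i (w, t) ≤ b i ↔ h i w ≤ b i) := by
    intro i w t hc
    rw [hf, hc, mul_zero, add_zero]
  have hmem : ∀ w t, (w, t) ∈ {z | ∀ i, f i z ≤ b i} ↔
      (∀ i, c i = 0 → h i w ≤ b i) ∧ (∀ i : {i // c i < 0}, v i w ≤ t) ∧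
        ∀ j : {j // 0 < c j}, t ≤ v j w := by
    intro w t
    constructor
    · intro H
      exact ⟨fun i hi => (hzero i w t hi).1 (H i), fun i => (hneg i w t i.2).1 (H i),
        fun j => (hpos j w t j.2).1 (H j)⟩
    · rintro ⟨h1, h2, h3⟩ i
      rcases lt_trichotomy (c i) 0 with hc | hc | hc
      · exact (hneg i w t hc).2 (h2 ⟨i, hc⟩)
      · exact (hzero i w t hc).2 (h1 i hc)
      · exact (hpos i w t hc).2 (h3 ⟨i, hc⟩)
  have hv : ∃ κ : ℝ, 0 ≤ κ ∧ ∀ i w w', |v i w - v i w'| ≤ κ * ‖w - w'‖ := by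
    let g : Fin k → ℝ := fun i => ‖LinearMap.toContinuousLinearMap (h i)‖ / |c i|
    have hg : ∀ i, 0 ≤ g i := fun i => by positivity
    refine ⟨∑ i, g i, Finset.sum_nonneg fun i _ => hg i, fun i w w' => ?_⟩
    have h1 : v i w - v i w' = h i (w' - w) / c i := by
      simp only [v, map_sub]; ring
    have h2 := (LinearMap.toContinuousLinearMap (h i)).le_opNorm (w' - w)
    simp only [LinearMap.coe_toContinuousLinearMap', Real.norm_eq_abs] at h2
    calc |v i w - v i w'| = |h i (w' - w)| / |c i| := by rw [h1, abs_div]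
      _ ≤ ‖LinearMap.toContinuousLinearMap (h i)‖ * ‖w' - w‖ / |c i| := by gcongr
      _ = g i * ‖w - w'‖ := by rw [norm_sub_rev]; simp only [g]; ring
      _ ≤ (∑ i, g i) * ‖w - w'‖ := by
        gcongr
        exact Finset.single_le_sum (f := g) (fun i _ => hg i) (Finset.mem_univ i)
  constructor
  · have key : LinearMap.fst ℝ W ℝ '' {z | ∀ i, f i z ≤ b i} =
        {w | ∀ p : {i // c i = 0} ⊕ ({i // c i < 0} × {j // 0 < c j}),
          (Sum.elim (fun i : {i // c i = 0} => h i)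
            (fun q : {i // c i < 0} × {j // 0 < c j} => c q.2 • h q.1 - c q.1 • h q.2) p) w ≤
          Sum.elim (fun i : {i // c i = 0} => b i)
            (fun q : {i // c i < 0} × {j // 0 < c j} => c q.2 * b q.1 - c q.1 * b q.2) p} := by
      have hcross : ∀ (i : {i // c i < 0}) (j : {j // 0 < c j}) w, v i w ≤ v j w ↔
          (c j • h i - c i • h j) w ≤ c j * b i - c i * b j := by
        intro i j w
        have hi := i.2
        have hj := j.2
        simp only [v, LinearMap.sub_apply, LinearMap.smul_apply, smul_eq_mul]
        rw [le_div_iff₀ hj, div_mul_eq_mul_div, div_le_iff_of_neg hi]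
        constructor <;> intro <;> linarith
      ext w
      constructor
      · rintro ⟨⟨w, t⟩, hz, rfl⟩ p
        obtain ⟨h1, h2, h3⟩ := (hmem w t).1 hz
        rcases p with i | ⟨i, j⟩
        · exact h1 i i.2
        · exact (hcross i j w).1 ((h2 i).trans (h3 j))
      · intro H
        have hδ : ∀ i, |v i w| ≤ ∑ i, |v i w| := fun i =>
          Finset.single_le_sum (f := fun i => |v i w|) (fun i _ => abs_nonneg _) (Finset.mem_univ i)
        obtain ⟨t, ht1, ht2, -⟩ := exists_near_between_of_forall_le
          (l := fun i : {i // c i < 0} => v i w) (u := fun j : {j // 0 < c j} => v j w) (t := 0)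
          (δ := ∑ i, |v i w|) (Finset.sum_nonneg fun i _ => abs_nonneg _)
          (fun i j => (hcross i j w).2 (H (Sum.inr (i, j))))
          (fun i => by linarith [hδ i, le_abs_self (v i w)])
          (fun j => by linarith [hδ j, neg_abs_le (v j w)])
        exact ⟨(w, t), (hmem w t).2 ⟨fun i hi => H (Sum.inl ⟨i, hi⟩), ht1, ht2⟩, rfl⟩
    rw [key]
    exact isPolyhedron_setOf _ _
  · obtain ⟨κ, hκ, hv⟩ := hv
    refine ⟨κ + 1, by linarith, ?_⟩
    rintro ⟨w, t⟩ hz ⟨w', t₀⟩ hz₀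
    obtain ⟨-, h2, h3⟩ := (hmem w t).1 hz
    obtain ⟨h1', h2', h3'⟩ := (hmem w' t₀).1 hz₀
    have hn := norm_nonneg (w - w')
    obtain ⟨t', ht1, ht2, ht3⟩ := exists_near_between_of_forall_le
      (l := fun i : {i // c i < 0} => v i w') (u := fun j : {j // 0 < c j} => v j w') (t := t)
      (δ := κ * ‖w - w'‖) (by positivity) (fun i j => (h2' i).trans (h3' j))
      (fun i => by linarith [h2 i, (abs_le.1 (hv i w w')).1])
      (fun j => by linarith [h3 j, (abs_le.1 (hv j w w')).2])
    refine ⟨(w', t'), (hmem w' t').2 ⟨h1', ht1, ht2⟩, rfl, ?_⟩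
    simp only [LinearMap.fst_apply, Prod.mk_sub_mk]
    rw [Prod.norm_mk, Real.norm_eq_abs]
    refine max_le ?_ ?_ <;> nlinarith

theorem hasLipschitzFibres_fst_pi {E : Type*} [NormedAddCommGroup E] [NormedSpace ℝ E]
    [FiniteDimensional ℝ E] (m : ℕ) : HasLipschitzFibres (LinearMap.fst ℝ E (Fin m → ℝ)) := by
  induction m with
  | zero =>
    let e : (E × (Fin 0 → ℝ)) ≃ₗ[ℝ] E :=
      { LinearMap.fst ℝ E (Fin 0 → ℝ) with
        invFun := fun x => (x, 0)
        left_inv := fun z => Prod.ext rfl (Subsingleton.elim _ _)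
        right_inv := fun _ => rfl }
    exact LinearEquiv.hasLipschitzFibres e
  | succ m ih =>
    let e : (E × (Fin (m + 1) → ℝ)) ≃ₗ[ℝ] (E × (Fin m → ℝ)) × ℝ :=
      { toFun := fun z => ((z.1, Fin.tail z.2), z.2 0)
        map_add' := fun _ _ => rfl
        map_smul' := fun _ _ => rfl
        invFun := fun z => (z.1.1, Fin.cons z.2 z.1.2)
        left_inv := fun z => by simp
        right_inv := fun z => by simp }
    exact (ih.comp hasLipschitzFibres_fst_real).comp (LinearEquiv.hasLipschitzFibres e)

theorem hasLipschitzFibres_fst (n m : ℕ) : HasLipschitzFibres (LinearMap.fst ℝ (Rn n) (Rn m)) := by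
  let e : (Rn n × Rn m) ≃ₗ[ℝ] Rn n × (Fin m → ℝ) :=
    (LinearEquiv.refl ℝ (Rn n)).prodCongr (EuclideanSpace.equiv (Fin m) ℝ).toLinearEquiv
  exact (hasLipschitzFibres_fst_pi m).comp (LinearEquiv.hasLipschitzFibres e)

end Polyhedra

section SignVector

variable {ι V : Type*} [AddCommGroup V] [Module ℝ V] {f : ι → V →ₗ[ℝ] ℝ} {b : ι → ℝ}

theorem mem_zeroDirections {z v : V} :
    v ∈ zeroDirections f b z ↔ ∀ i, f i z = b i → f i v = 0 := by
  simp [zeroDirections, Submodule.mem_iInf]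

theorem signVector_eq_zero_iff {z : V} {i : ι} : signVector f b z i = 0 ↔ f i z = b i := by
  rw [signVector, sign_eq_zero_iff, sub_eq_zero]

theorem zeroDirections_congr {z z' : V} (h : signVector f b z = signVector f b z') :
    zeroDirections f b z = zeroDirections f b z' := by
  ext v
  simp only [mem_zeroDirections, ← signVector_eq_zero_iff, h]

end SignVector

section Germs

variable {ι V : Type*} [Finite ι] [NormedAddCommGroup V] [NormedSpace ℝ V] [FiniteDimensional ℝ V]
  {f : ι → V →ₗ[ℝ] ℝ} {b : ι → ℝ}

/-- Nearby points share all nonzero signs. -/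
theorem eventually_sign_eq (z : V) :
    ∀ᶠ x in 𝓝 z, ∀ i, f i z ≠ b i → signVector f b x i = signVector f b z i := by
  rw [eventually_all]
  intro i
  have hc : Continuous fun x => f i x - b i :=
    (LinearMap.continuous_of_finiteDimensional (f i)).sub continuous_const
  rcases lt_trichotomy (f i z - b i) 0 with h | h | h
  · filter_upwards [hc.continuousAt.eventually_lt continuousAt_const h] with x hx _
    rw [signVector, signVector, sign_neg h, sign_neg hx]
  · exact Eventually.of_forall fun x hx => absurd (sub_eq_zero.1 h) hx
  · filter_upwards [continuousAt_const.eventually_lt hc.continuousAt h] with x hx _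
    rw [signVector, signVector, sign_pos h, sign_pos hx]

theorem eventually_signVector_add_eq {z z' : V} (h : signVector f b z = signVector f b z') :
    ∀ᶠ v in 𝓝 (0 : V), signVector f b (z + v) = signVector f b (z' + v) := by
  have hz : ∀ y : V, Tendsto (fun v => y + v) (𝓝 0) (𝓝 y) := fun y =>
    (continuous_const_add y).tendsto' 0 y (add_zero y)
  filter_upwards [(hz z).eventually (eventually_sign_eq (f := f) (b := b) z),
    (hz z').eventually (eventually_sign_eq (f := f) (b := b) z')] with v h1 h2
  ext1 i
  by_cases hi : f i z = b i
  · have hi' : f i z' = b i := by rwa [← signVector_eq_zero_iff, ← h, signVector_eq_zero_iff]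
    simp [signVector, hi, hi']
  · have hi' : f i z' ≠ b i := by rwa [Ne, ← signVector_eq_zero_iff, ← h, signVector_eq_zero_iff]
    rw [h1 i hi, h2 i hi', h]

theorem eventually_signVector_eq_of_mem (z : V) :
    ∀ᶠ v in 𝓝 (0 : V), v ∈ zeroDirections f b z →
      signVector f b (z + v) = signVector f b z := by
  have hz : Tendsto (fun v => z + v) (𝓝 0) (𝓝 z) :=
    (continuous_const_add z).tendsto' 0 z (add_zero z)
  filter_upwards [hz.eventually (eventually_sign_eq (f := f) (b := b) z)] with v h1 hv
  ext1 i
  by_cases hi : f i z = b i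
  · simp [signVector, hi, mem_zeroDirections.1 hv i hi]
  · exact h1 i hi

theorem eventually_mem_iff_of_signVector_eq {A : Set V}
    (hA : ∀ z z', signVector f b z = signVector f b z' → z ∈ A → z' ∈ A) {z z' : V}
    (h : signVector f b z = signVector f b z') : ∀ᶠ v in 𝓝 (0 : V), z + v ∈ A ↔ z' + v ∈ A := by
  filter_upwards [eventually_signVector_add_eq h] with v hv
  exact ⟨hA _ _ hv, hA _ _ hv.symm⟩

/-- Near a point of a union of cells whose zero directions have the largest possible dimension,
there is only the cell of that point. -/
theorem eventually_signVector_eq_of_finrank_le {A : Set V} {a : V}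
    (h : ∀ x ∈ A, Module.finrank ℝ (zeroDirections f b x) ≤
      Module.finrank ℝ (zeroDirections f b a)) :
    ∀ᶠ x in 𝓝[A] a, signVector f b x = signVector f b a := by
  filter_upwards [nhdsWithin_le_nhds (eventually_sign_eq (f := f) (b := b) a),
    self_mem_nhdsWithin] with x hx hxA
  have hZ : ∀ i, f i x = b i → f i a = b i := by
    intro i hi
    by_contra hne
    have := hx i hne
    rw [signVector_eq_zero_iff.2 hi] at this
    exact hne (signVector_eq_zero_iff.1 this.symm)
  have hle : zeroDirections f b a ≤ zeroDirections f b x := fun v hv =>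
    mem_zeroDirections.2 fun i hi => mem_zeroDirections.1 hv i (hZ i hi)
  have heq := Submodule.eq_of_le_of_finrank_le hle (h x hxA)
  have hxa : x - a ∈ zeroDirections f b a := by
    rw [heq, mem_zeroDirections]
    intro i hi
    rw [map_sub, hi, hZ i hi, sub_self]
  ext1 i
  by_cases hi : f i a = b i
  · have := mem_zeroDirections.1 hxa i hi
    rw [map_sub, sub_eq_zero, hi] at this
    rw [signVector_eq_zero_iff.2 hi, signVector_eq_zero_iff.2 this]
  · exact hx i hi

end Germs

section Dimension

variable {n : ℕ} {ι : Type*} [Finite ι] {f : ι → Rn n →ₗ[ℝ] ℝ} {b : ι → ℝ}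

theorem containsManifold_of_signVector_eq {A : Set (Rn n)} {a : Rn n}
    (hA : ∀ x, signVector f b a = signVector f b x → x ∈ A) :
    ContainsManifold A (Module.finrank ℝ (zeroDirections f b a)) := by
  let K := zeroDirections f b a
  let e : Rn (Module.finrank ℝ K) ≃L[ℝ] K :=
    ContinuousLinearEquiv.ofFinrankEq (by simp)
  let T : Rn (Module.finrank ℝ K) →L[ℝ] Rn n := K.subtypeL.comp (e : Rn (Module.finrank ℝ K) →L[ℝ] K)
  have hT : Function.Injective T := Subtype.val_injective.comp e.injective
  obtain ⟨ε, hε, hball⟩ := Metric.eventually_nhds_iff.1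
    (eventually_signVector_eq_of_mem (f := f) (b := b) a)
  refine ⟨T ⁻¹' Metric.ball 0 ε, fun u => a + T u, Metric.isOpen_ball.preimage T.continuous,
    ⟨0, by simpa using hε⟩, (contDiff_const.add T.contDiff).contDiffOn, fun u _ => ?_, ?_⟩
  · rw [fderiv_const_add, T.fderiv]
    exact hT
  · rintro _ ⟨u, hu, rfl⟩
    exact hA _ (hball hu (e u).2).symm

theorem ContainsManifold.exists_le_finrank {A : Set (Rn n)} {d : ℕ} (h : ContainsManifold A d) :
    ∃ x ∈ A, d ≤ Module.finrank ℝ (zeroDirections f b x) := by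
  obtain ⟨U, φ, hU, hne, hφ, hinj, hsub⟩ := h
  let Z : Rn n → Set ι := fun x => {i | f i x = b i}
  let N : Rn d → ℕ := fun u => (Z (φ u)).ncard
  obtain ⟨u, hu, hmin⟩ : ∃ u ∈ U, ∀ u' ∈ U, N u ≤ N u' := by
    obtain ⟨u, hu, h⟩ := (wellFounded_lt.onFun (f := N)).has_min U hne
    exact ⟨u, hu, fun u' hu' => not_lt.1 (h u' hu')⟩
  refine ⟨φ u, hsub ⟨u, hu, rfl⟩, ?_⟩
  have hUu : U ∈ 𝓝 u := hU.mem_nhds hu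
  have hdiff : DifferentiableAt ℝ φ u := (hφ.contDiffAt hUu).differentiableAt one_ne_zero
  have hconst : ∀ᶠ u' in 𝓝 u, Z (φ u') = Z (φ u) := by
    filter_upwards [hUu, hdiff.continuousAt.eventually
      (eventually_sign_eq (f := f) (b := b) (φ u))] with u' hu' hs
    refine Set.eq_of_subset_of_ncard_le (fun i hi => ?_) (hmin u' hu') (Set.toFinite _)
    by_contra hne
    have := hs i hne
    rw [signVector_eq_zero_iff.2 hi] at this
    exact hne (signVector_eq_zero_iff.1 this.symm)
  have hrange : ∀ v, fderiv ℝ φ u v ∈ zeroDirections f b (φ u) := by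
    intro v
    rw [mem_zeroDirections]
    intro i hi
    let T := LinearMap.toContinuousLinearMap (f i)
    have h1 : HasFDerivAt (fun u' => T (φ u')) (T.comp (fderiv ℝ φ u)) u :=
      T.hasFDerivAt.comp u hdiff.hasFDerivAt
    have h2 : (fun u' => T (φ u')) =ᶠ[𝓝 u] fun _ => b i := by
      filter_upwards [hconst] with u' hu'
      exact (Set.ext_iff.1 hu' i).2 hi
    have h3 := h1.unique ((hasFDerivAt_const (b i) u).congr_of_eventuallyEq h2)
    exact DFunLike.congr_fun h3 v
  have hinj' : Function.Injective
      ((fderiv ℝ φ u : Rn d →ₗ[ℝ] Rn n).codRestrict (zeroDirections f b (φ u)) hrange) :=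
    fun v w hvw => hinj u hu (congrArg Subtype.val hvw)
  simpa using LinearMap.finrank_le_finrank_of_injective hinj'

theorem coe_le_semialgDim {A : Set (Rn n)} {d : ℕ} (h : ContainsManifold A d) :
    ((d : ℕ∞) : WithBot ℕ∞) ≤ semialgDim A :=
  le_iSup₂_of_le d h le_rfl

theorem semialgDim_lt_coe {A : Set (Rn n)} {d : ℕ} (h : ∀ k, ContainsManifold A k → k < d) :
    semialgDim A < ((d : ℕ∞) : WithBot ℕ∞) := by
  cases d with
  | zero =>
    have : semialgDim A ≤ ⊥ := iSup₂_le fun k hk => absurd (h k hk) (Nat.not_lt_zero k)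
    exact this.trans_lt (WithBot.bot_lt_coe _)
  | succ d =>
    have : semialgDim A ≤ ((d : ℕ∞) : WithBot ℕ∞) := iSup₂_le fun k hk =>
      WithBot.coe_le_coe.2 (Nat.cast_le.2 (Nat.lt_succ_iff.1 (h k hk)))
    exact this.trans_lt (WithBot.coe_lt_coe.2 (Nat.cast_lt.2 d.lt_succ_self))

end Dimension

/-- The polynomial of the affine function `f - b`. -/
noncomputable def affinePolynomial {n : ℕ} (f : Rn n →ₗ[ℝ] ℝ) (b : ℝ) : MvPolynomial (Fin n) ℝ :=
  ∑ j, MvPolynomial.C (f (EuclideanSpace.single j 1)) * MvPolynomial.X j - MvPolynomial.C b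

theorem eval_affinePolynomial {n : ℕ} (f : Rn n →ₗ[ℝ] ℝ) (b : ℝ) (x : Rn n) :
    MvPolynomial.eval (fun j => x j) (affinePolynomial f b) = f x - b := by
  have h := congrArg f ((EuclideanSpace.basisFun (Fin n) ℝ).sum_repr x)
  rw [map_sum] at h
  simp only [map_smul, smul_eq_mul, EuclideanSpace.basisFun_apply,
    EuclideanSpace.basisFun_repr] at h
  simp [affinePolynomial, ← h, mul_comm]

theorem isSemialgebraic_of_signVector {n : ℕ} {ι : Type*} [Fintype ι] {f : ι → Rn n →ₗ[ℝ] ℝ}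
    {b : ι → ℝ} {A : Set (Rn n)}
    (hA : ∀ z z', signVector f b z = signVector f b z' → z ∈ A → z' ∈ A) :
    IsSemialgebraic A := by
  classical
  let J := {s : ι → SignType // ∃ a ∈ A, signVector f b a = s}
  let g : ι → MvPolynomial (Fin n) ℝ := fun i => affinePolynomial (f i) (b i)
  let σ : Fin (Fintype.card J) → ι → SignType := fun k => ((Fintype.equivFin J).symm k).1
  have hcell : ∀ (s : ι → SignType) (x : Rn n), signVector f b x = s ↔
      MvPolynomial.eval (fun j => x j) (∑ i with s i = 0, g i ^ 2) = 0 ∧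
      ∀ r ∈ ({i | s i ≠ 0} : Finset ι).image (fun i => MvPolynomial.C (s i : ℝ) * g i),
        0 < MvPolynomial.eval (fun j => x j) r := by
    intro s x
    have h0 : MvPolynomial.eval (fun j => x j) (∑ i with s i = 0, g i ^ 2) = 0 ↔
        ∀ i, s i = 0 → f i x - b i = 0 := by
      simp only [map_sum, map_pow, g, eval_affinePolynomial]
      rw [Finset.sum_eq_zero_iff_of_nonneg fun i _ => sq_nonneg _]
      simp
    rw [h0]
    simp only [Finset.forall_mem_image, Finset.mem_filter, Finset.mem_univ, true_and, map_mul,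
      MvPolynomial.eval_C, g, eval_affinePolynomial, funext_iff, signVector]
    rw [← forall_and]
    refine forall_congr' fun i => ?_
    rcases hs : s i with _ | _ | _
    · simp [SignType.zero_eq_zero, sign_eq_zero_iff]
    · simp [SignType.neg_eq_neg_one, sign_eq_neg_one_iff]
    · simp [SignType.pos_eq_one, sign_eq_one_iff]
  refine ⟨Fintype.card J, fun k => ∑ i with σ k i = 0, g i ^ 2,
    fun k => ({i | σ k i ≠ 0} : Finset ι).image (fun i => MvPolynomial.C (σ k i : ℝ) * g i), ?_⟩
  ext x
  rw [mem_iUnion]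
  constructor
  · intro hx
    refine ⟨Fintype.equivFin J ⟨signVector f b x, x, hx, rfl⟩, (hcell _ x).1 ?_⟩
    simp [σ]
  · rintro ⟨k, hk⟩
    obtain ⟨a, ha, has⟩ := ((Fintype.equivFin J).symm k).2
    exact hA a x (has.trans ((hcell (σ k) x).2 hk).symm) ha

section StrictContinuity

variable {n m : ℕ} {X : Set (Rn n)} {S : Rn n → Set (Rn m)}

theorem truncHausdorffDist_le {ρ : ℝ} {A B : Set (Rn m)} {δ : ℝ≥0} (hδ : 0 < δ)
    (hAB : A ⊆ B + Metric.closedBall 0 (δ : ℝ)) (hBA : B ⊆ A + Metric.closedBall 0 (δ : ℝ)) :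
    truncHausdorffDist ρ A B ≤ δ :=
  iInf₂_le δ ⟨hδ, inter_subset_left.trans hAB, inter_subset_left.trans hBA⟩

theorem strictlyContinuousAt_of_lipschitz {a : Rn n} {κ : ℝ} {N : Set (Rn n)} (hN : N ∈ 𝓝[X] a)
    (h : ∀ x ∈ N, ∀ x' ∈ N, S x' ⊆ S x + Metric.closedBall 0 (κ * ‖x' - x‖)) :
    StrictlyContinuousAt X S a := by
  intro ρ _
  let c : ℝ≥0 := κ.toNNReal + 1
  have hc : κ ≤ c := (Real.le_coe_toNNReal κ).trans (by simp [c])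
  refine lt_of_le_of_lt (b := (c : ℝ≥0∞)) ?_ ENNReal.coe_lt_top
  refine limsup_le_of_le (by isBoundedDefault) ?_
  have hNN : N ×ˢ N ∈ 𝓝[X] a ×ˢ 𝓝[X] a := prod_mem_prod hN hN
  filter_upwards [mem_inf_of_left hNN, mem_inf_of_right (mem_principal_self _)]
    with ⟨x, x'⟩ ⟨hx, hx'⟩ hne
  have hpos : 0 < ‖x - x'‖₊ := nnnorm_pos.2 (sub_ne_zero.2 hne)
  rw [ENNReal.div_le_iff (by simpa [sub_eq_zero] using hne) (by simp)]
  have hsub : ∀ y ∈ N, ∀ y' ∈ N, ‖y' - y‖ = ‖x - x'‖ →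
      S y' ⊆ S y + Metric.closedBall 0 ((c * ‖x - x'‖₊ : ℝ≥0) : ℝ) := by
    intro y hy y' hy' he
    refine (h y hy y' hy').trans (add_subset_add_left (Metric.closedBall_subset_closedBall ?_))
    rw [he, NNReal.coe_mul, coe_nnnorm]
    gcongr
  have := truncHausdorffDist_le (ρ := ρ) (δ := c * ‖x - x'‖₊) (by positivity)
    (hsub x' hx' x hx rfl) (hsub x hx x' hx' (norm_sub_rev _ _))
  rwa [ENNReal.coe_mul] at this

theorem exists_semialgebraic_strictlyContinuousAt (hX : IsPiecewisePolyhedral X)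
    (hXne : X.Nonempty) (hS : IsPiecewisePolyhedral (setValuedGraph X S)) :
    ∃ X' : Set (Rn n), X' ⊆ X ∧ IsSemialgebraic X' ∧ semialgDim X' < semialgDim X ∧
      ∀ a ∈ X \ X', StrictlyContinuousAt X S a := by
  obtain ⟨N₁, P, hP, rfl⟩ := hX
  obtain ⟨N₂, Q, hQ, hgraph⟩ := hS
  have hproj := fun k => hasLipschitzFibres_fst n m (Q k) (hQ k)
  choose hR κ hκ hlip using hproj
  obtain ⟨ι, hι, f, b, hdet⟩ := exists_signVector_determines
    (P := Sum.elim P fun k => LinearMap.fst ℝ (Rn n) (Rn m) '' Q k)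
    (fun k => by cases k with
      | inl k => exact hP k
      | inr k => exact hR k)
  set X : Set (Rn n) := ⋃ i, P i with hXdef
  have hXdet : ∀ z z', signVector f b z = signVector f b z' → z ∈ X → z' ∈ X := by
    intro z z' hs hz
    rw [hXdef, mem_iUnion] at hz ⊢
    exact hz.imp fun k hk => hdet (Sum.inl k) z z' hs hk
  let D : Rn n → ℕ := fun x => Module.finrank ℝ (zeroDirections f b x)
  have hDn : ∀ x, D x ≤ n := fun x => by simpa using (zeroDirections f b x).finrank_le
  obtain ⟨a₀, ha₀, hmax⟩ : ∃ a₀ ∈ X, ∀ x ∈ X, D x ≤ D a₀ := by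
    have hfin : (D '' X).Finite := (Set.finite_Iic n).subset (by
      rintro _ ⟨x, -, rfl⟩
      exact hDn x)
    obtain ⟨_, ⟨a₀, ha₀, rfl⟩, h⟩ := exists_max_image _ id hfin (hXne.image D)
    exact ⟨a₀, ha₀, fun x hx => h _ ⟨x, hx, rfl⟩⟩
  refine ⟨{x ∈ X | D x < D a₀}, sep_subset _ _, ?_, ?_, ?_⟩
  · refine isSemialgebraic_of_signVector (f := f) (b := b) fun z z' hs hz => ?_
    refine ⟨hXdet z z' hs hz.1, ?_⟩
    have := hz.2
    simp only [D] at this ⊢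
    rwa [← zeroDirections_congr hs]
  · refine (semialgDim_lt_coe fun k hk => ?_).trans_le
      (coe_le_semialgDim (containsManifold_of_signVector_eq (f := f) (b := b) (a := a₀)
        fun x hx => hXdet _ _ hx ha₀))
    obtain ⟨x, hx, hle⟩ := hk.exists_le_finrank (f := f) (b := b)
    exact hle.trans_lt hx.2
  · rintro a ⟨haX, ha⟩
    have hDa : D a₀ ≤ D a := not_lt.1 fun h => ha ⟨haX, h⟩
    have hev := eventually_signVector_eq_of_finrank_le (f := f) (b := b) (A := X) (a := a)
      fun x hx => (hmax x hx).trans hDa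
    refine strictlyContinuousAt_of_lipschitz (κ := ∑ k, κ k)
      (inter_mem hev self_mem_nhdsWithin) ?_
    rintro x ⟨hx, hxX⟩ x' ⟨hx', hxX'⟩ y' hy'
    have hz' : (x', y') ∈ setValuedGraph X S := ⟨hxX', hy'⟩
    rw [hgraph, mem_iUnion] at hz'
    obtain ⟨k, hk⟩ := hz'
    obtain ⟨z₀, hz₀, hz₀x⟩ : x ∈ LinearMap.fst ℝ (Rn n) (Rn m) '' Q k :=
      hdet (Sum.inr k) x' x (Eq.trans hx' (Eq.symm hx)) ⟨(x', y'), hk, rfl⟩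
    obtain ⟨⟨w, y⟩, hy, hw, hle⟩ := hlip k (x', y') hk z₀ hz₀
    rw [hz₀x] at hw hle
    obtain rfl : w = x := hw
    have hyS : (w, y) ∈ setValuedGraph X S := by
      rw [hgraph]
      exact mem_iUnion.2 ⟨k, hy⟩
    refine ⟨y, hyS.2, y' - y, ?_, by simp⟩
    rw [mem_closedBall_zero_iff]
    calc ‖y' - y‖ ≤ ‖((x', y') : Rn n × Rn m) - (w, y)‖ := by
          rw [Prod.mk_sub_mk]; exact le_max_right _ _
      _ ≤ κ k * ‖x' - w‖ := hle
      _ ≤ (∑ k, κ k) * ‖x' - w‖ := by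
        gcongr
        exact Finset.single_le_sum (f := κ) (fun k _ => hκ k) (Finset.mem_univ k)

end StrictContinuity

section GraphicalModulus

variable {n m : ℕ} {X : Set (Rn n)} {S : Rn n → Set (Rn m)}

theorem StrictlyContinuousAt.graphicalModulus_lt_top {a : Rn n}
    (h : StrictlyContinuousAt X S a) (u : Rn m) : graphicalModulus X S a u < ⊤ := by
  have hρ : 0 < ‖u‖ + 1 := by positivity
  obtain ⟨c, hc, -⟩ := ENNReal.lt_iff_exists_nnreal_btwn.1 (h _ hρ)
  have hev := eventually_lt_of_limsup_lt hc
  rw [eventually_inf_principal] at hev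
  obtain ⟨p, hp, q, hq, hpq⟩ := Filter.eventually_prod_iff.1 hev
  rw [eventually_nhdsWithin_iff] at hp hq
  refine lt_of_le_of_lt (iInf₂_le c ⟨{x | x ∈ X → p x} ∩ {x | x ∈ X → q x}, inter_mem hp hq,
    Metric.ball u 1, Metric.ball_mem_nhds u one_pos, ?_⟩) ENNReal.coe_lt_top
  rintro x ⟨hxX, hxp, hxq⟩ x' ⟨hx'X, hx'p, hx'q⟩ y ⟨hy, hyu⟩
  by_cases hne : x' = x
  · subst hne
    exact ⟨y, hy, 0, by simp, by simp⟩
  have hlt := hpq (hx'p hx'X) (hxq hxX) hne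
  rw [ENNReal.div_lt_iff (Or.inl (by simpa [sub_eq_zero] using hne)) (Or.inl (by simp))] at hlt
  simp only [truncHausdorffDist, iInf_lt_iff] at hlt
  obtain ⟨δ, ⟨-, hδ, -⟩, hlt⟩ := hlt
  have hyρ : y ∈ Metric.closedBall (0 : Rn m) (‖u‖ + 1) := by
    rw [mem_closedBall_zero_iff]
    have := norm_le_norm_add_norm_sub' y u
    rw [Metric.mem_ball, dist_eq_norm] at hyu
    linarith
  refine add_subset_add_left (Metric.closedBall_subset_closedBall ?_) (hδ ⟨hy, hyρ⟩)
  have : δ < c * ‖x' - x‖₊ := by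
    rw [enorm_eq_nnnorm] at hlt
    exact_mod_cast hlt
  exact_mod_cast this.le

theorem graphicalModulus_le_of_germ {a a' : Rn n} {u u' : Rn m}
    (hX : ∀ᶠ v in 𝓝 (0 : Rn n), a + v ∈ X ↔ a' + v ∈ X)
    (hS : ∀ᶠ v in 𝓝 (0 : Rn n × Rn m),
      (a, u) + v ∈ setValuedGraph X S ↔ (a', u') + v ∈ setValuedGraph X S) :
    graphicalModulus X S a' u' ≤ graphicalModulus X S a u := by
  refine le_iInf₂ fun κ ⟨V, hV, W, hW, h⟩ => iInf₂_le κ ?_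
  obtain ⟨r₁, hr₁, hV⟩ := Metric.mem_nhds_iff.1 hV
  obtain ⟨r₂, hr₂, hW⟩ := Metric.mem_nhds_iff.1 hW
  obtain ⟨r₃, hr₃, hX⟩ := Metric.eventually_nhds_iff.1 hX
  obtain ⟨r₄, hr₄, hS⟩ := Metric.eventually_nhds_iff.1 hS
  simp only [dist_zero_right] at hX hS
  obtain ⟨s, hs, hs₂, hs₄⟩ : ∃ s, 0 < s ∧ s ≤ r₂ ∧ s ≤ r₄ / 2 :=
    ⟨min r₂ (r₄ / 2), by positivity, min_le_left _ _, min_le_right _ _⟩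
  obtain ⟨r, hr, hrr₁, hrr₃, hrr₄, hκr⟩ :
      ∃ r, 0 < r ∧ r ≤ r₁ ∧ r ≤ r₃ ∧ r ≤ r₄ ∧ κ * (2 * r) ≤ r₄ / 2 := by
    refine ⟨min (min r₁ r₃) (min r₄ (r₄ / (4 * (κ + 1)))), by positivity,
      (min_le_left _ _).trans (min_le_left _ _), (min_le_left _ _).trans (min_le_right _ _),
      (min_le_right _ _).trans (min_le_left _ _), ?_⟩
    have h1 : min (min r₁ r₃) (min r₄ (r₄ / (4 * ((κ : ℝ) + 1)))) ≤ r₄ / (4 * (κ + 1)) :=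
      (min_le_right _ _).trans (min_le_right _ _)
    calc (κ : ℝ) * (2 * _) ≤ (κ + 1) * (2 * (r₄ / (4 * (κ + 1)))) := by
          gcongr
          linarith
      _ = r₄ / 2 := by field_simp; norm_num
  refine ⟨Metric.ball a' r, Metric.ball_mem_nhds _ hr, Metric.ball u' s,
    Metric.ball_mem_nhds _ hs, ?_⟩
  have htrans : ∀ x ∈ X ∩ Metric.ball a' r, a + (x - a') ∈ X ∩ V := by
    rintro x ⟨hx, hxr⟩
    rw [mem_ball_iff_norm] at hxr
    refine ⟨(hX (hxr.trans_le hrr₃)).2 (by simpa using hx), hV ?_⟩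
    rw [mem_ball_iff_norm, add_sub_cancel_left]
    exact hxr.trans_le hrr₁
  intro x hx x' hx' y' hy'
  have hxr := mem_ball_iff_norm.1 hx.2
  have hxr' := mem_ball_iff_norm.1 hx'.2
  have hyr' := mem_ball_iff_norm.1 hy'.2
  have h1 : (a, u) + (x' - a', y' - u') ∈ setValuedGraph X S := by
    refine (hS ?_).2 ?_
    · rw [Prod.norm_mk]
      exact max_lt (by linarith) (by linarith)
    · rw [Prod.mk_add_mk, add_sub_cancel, add_sub_cancel]
      exact ⟨hx'.1, hy'.1⟩
  obtain ⟨y, hy, w, hw, hyw⟩ := h _ (htrans x hx) _ (htrans x' hx')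
    ⟨h1.2, hW (mem_ball_iff_norm.2 (by simpa using hyr'.trans_le hs₂))⟩
  have hxx : a + (x' - a') - (a + (x - a')) = x' - x := by abel
  rw [hxx] at hw
  have hyw' : y + w = u + (y' - u') := hyw
  refine ⟨y - u + u', ?_, w, hw, ?_⟩
  · have hyu : ‖y - u‖ < r₄ := by
      have e : y - u = (y' - u') - w := by
        rw [eq_sub_iff_add_eq, ← add_sub_cancel_left u (y' - u'), ← hyw']
        abel
      have h2 : ‖w‖ ≤ κ * (2 * r) := by
        refine (mem_closedBall_zero_iff.1 hw).trans ?_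
        gcongr
        have := norm_sub_le (x' - a') (x - a')
        rw [sub_sub_sub_cancel_right] at this
        linarith
      rw [e]
      have := norm_sub_le (y' - u') w
      linarith
    have h3 : (a', u') + (x - a', y - u) ∈ setValuedGraph X S := by
      refine (hS ?_).1 ⟨(htrans x hx).1, by simpa using hy⟩
      rw [Prod.norm_mk]
      exact max_lt (by linarith) hyu
    simpa [add_comm] using h3.2
  · change y - u + u' + w = y'
    have : y - u + u' + w = (y + w) - u + u' := by abel
    rw [this, hyw']
    abel

theorem exists_graphicalModulus_lt (hX : IsPiecewisePolyhedral X)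
    (hS : IsPiecewisePolyhedral (setValuedGraph X S)) :
    ∃ κ : ℝ, 0 < κ ∧ ∀ a ∈ X, StrictlyContinuousAt X S a →
      ∀ u ∈ S a, graphicalModulus X S a u < ENNReal.ofReal κ := by
  obtain ⟨ι₁, _, f₁, b₁, h₁⟩ := hX.exists_signVector
  obtain ⟨ι₂, _, f₂, b₂, h₂⟩ := hS.exists_signVector
  classical
  have key : ∀ t : (ι₁ → SignType) × (ι₂ → SignType), ∃ κ : ℝ≥0, ∀ a u,
      StrictlyContinuousAt X S a → (signVector f₁ b₁ a, signVector f₂ b₂ (a, u)) = t →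
      graphicalModulus X S a u ≤ κ := by
    intro t
    by_cases ht : ∃ a u, StrictlyContinuousAt X S a ∧
        (signVector f₁ b₁ a, signVector f₂ b₂ (a, u)) = t
    · obtain ⟨a, u, ha, rfl⟩ := ht
      lift graphicalModulus X S a u to ℝ≥0 using (ha.graphicalModulus_lt_top u).ne with κ hκ
      refine ⟨κ, fun a' u' _ ht' => ?_⟩
      rw [hκ]
      obtain ⟨e₁, e₂⟩ := Prod.mk.inj ht'
      exact graphicalModulus_le_of_germ (eventually_mem_iff_of_signVector_eq h₁ e₁.symm)
        (eventually_mem_iff_of_signVector_eq h₂ e₂.symm)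
    · exact ⟨0, fun a u ha e => absurd ⟨a, u, ha, e⟩ ht⟩
  choose κ hκ using key
  refine ⟨((∑ t, κ t + 1 : ℝ≥0) : ℝ), by positivity, fun a _ ha u _ => ?_⟩
  rw [ENNReal.ofReal_coe_nnreal]
  refine (hκ _ a u ha rfl).trans_lt (ENNReal.coe_lt_coe.2 ?_)
  exact (Finset.single_le_sum (f := κ) (fun _ _ => zero_le) (Finset.mem_univ _)).trans_lt
    (lt_add_one _)

end GraphicalModulus

theorem mainTheorem5 {n m : ℕ} (X : Set (Rn n)) (S : Rn n → Set (Rn m))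
    (hX : IsPiecewisePolyhedral X) (hXne : X.Nonempty)
    (hS : IsPiecewisePolyhedral (setValuedGraph X S)) :
    (∃ X' : Set (Rn n), X' ⊆ X ∧ IsSemialgebraic X' ∧ semialgDim X' < semialgDim X ∧
      ∀ a ∈ X \ X', StrictlyContinuousAt X S a) ∧
    ∃ κ : ℝ, 0 < κ ∧ ∀ a ∈ X, StrictlyContinuousAt X S a →
      ∀ u ∈ S a, graphicalModulus X S a u < ENNReal.ofReal κ := by
  exact ⟨exists_semialgebraic_strictlyContinuousAt hX hXne hS, exists_graphicalModulus_lt hX hS⟩
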